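/- Consider $N$ parallel FCFS servers, each working at unit rate. Jobs arrive according to a Poisson process of rate $\lambda>0$. Each job is replicated to $d$ servers $s_1,\dots,s_d$, $1\le d\le N$, chosen uniformly at random without replacement; its $d$ replicas have i.i.d. service requirements $B_1,\dots,B_d$ distributed as $B$, independent of everything else, and as soon as the first replica completes service the other $d-1$ are abandoned. Thus, if a job finds workloads $\omega_1,\dots,\omega_N$ and its replicas have service requirements $b_1,\dots,b_d$, its latency is $T=\min_j(\omega_{s_j}+b_j)$ and the workload of each sampled server $s_j$ becomes $\max\{T,\omega_{s_j}\}$. Suppose that $B$ is scaled Bernoulli: $B=X\cdot K$ with probability $1-p$ and $B=0$ with probability $p$, where $K\ge 1$, $X$ is a strictly positive random variable with $\mathbb E[X]=1$, and $p=1-1/K$ (so that $\mathbb E[B]=1$). Let $X_1,\dots,X_d$ be i.i.d. copies of $X$, and assume $$(1-p)^d\,\lambda\,\mathbb E[\min\{X_1,\dots,X_d\}]\,K<1 .$$ Then the Markov chain of workload vectors found by successive arriving jobs has a stationary probability distribution, and under every stationary distribution the waiting time $W$ of an arriving job satisfies $$\mathbb E[W]\;\le\;\frac{(1-p)^d\,\lambda\,\mathbb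 E\big[\min\{X_1,\dots,X_d\}^2\big]\,K^2}{2\big(1-(1-p)^d\,\lambda\,\mathbb E[\min\{X_1,\dots,X_d\}]\,K\big)}$$ (the right-hand side being $+\infty$ if $\mathbb E[\min\{X_1,\dots,X_d\}^2]=\infty$), a bound that does not depend on $N$. This holds under each of the following conventions for the waiting time: $W=T-\min_j b_j$; $W=\omega_{s_{j^*}}$, where $j^*$ is any minimizer of $\omega_{s_j}+b_j$; and $W=\min_j\omega_{s_j}$. -/

import Mathlib

open MeasureTheory ProbabilityTheory

open scoped ENNReal

namespace Redundancy

/-- Law of a scaled Bernoulli service requirement: `B = X * K` with probability `1 - p` and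
`B = 0` with probability `p`, where `μ` is the law of `X`. -/
noncomputable def scaledBernoulli (μ : Measure ℝ) (K p : ℝ) : Measure ℝ :=
  ENNReal.ofReal (1 - p) • μ.map (fun x => x * K) + ENNReal.ofReal p • Measure.dirac 0

/-- The data of one arriving job: the servers `s j` to which its `d` replicas are sent, the service
requirements `b j` of the replicas, and the time that elapses until the next arrival. -/
abbrev Job (N d : ℕ) : Type := (Fin d → Fin N) × (Fin d → ℝ) × ℝ

/-- Law of the data of a job: the `d` servers are sampled uniformly without replacement from
the `N` servers, the replicas have i.i.d. service requirements with law `β`, and the time until the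
next arrival is exponential with rate `lam` (Poisson arrivals); all of these are independent. -/
noncomputable def jobLaw (N d : ℕ) (lam : ℝ) (β : Measure ℝ) : Measure (Job N d) :=
  (uniformOn {s : Fin d → Fin N | Function.Injective s}).prod
    ((Measure.pi fun _ : Fin d => β).prod (expMeasure lam))

variable {N d : ℕ}

/-- Latency of a job that finds the workload vector `w`: its first replica finishes after
`min_j (w_{s_j} + b_j)`, and the job is then complete. -/
noncomputable def latency (w : Fin N → ℝ) (x : Job N d) : ℝ :=
  ⨅ j : Fin d, (w (x.1 j) + x.2.1 j)

open Classical in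
/-- Workload vector just after the arrival of a job (cancel-on-completion): the workload of each
sampled server becomes the maximum of its old value and the latency of the job; the other workloads
do not change. -/
noncomputable def afterArrival (w : Fin N → ℝ) (x : Job N d) : Fin N → ℝ :=
  fun i => if ∃ j, x.1 j = i then max (latency w x) (w i) else w i

/-- Workload vector found by the next job: until its arrival every server works at unit rate as long
as it has work. -/
noncomputable def nextWorkload (w : Fin N → ℝ) (x : Job N d) : Fin N → ℝ :=
  fun i => max (afterArrival w x i - x.2.2) 0

/-- `π` is a stationary law of the workload vector found by an arriving job. -/
def IsStationary (N d : ℕ) (lam : ℝ) (β : Measure ℝ) (π : Measure (Fin N → ℝ)) : Prop :=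
  IsProbabilityMeasure π ∧
    (π.prod (jobLaw N d lam β)).map (fun z => nextWorkload z.1 z.2) = π

/-- `W w x` is the waiting time of job `x` when it finds workload vector `w`. The three customary
conventions are all admitted:
the latency in excess of the smallest service requirement `min_j b_j`;
the time until the replica that completes the job (any minimizer of `w_{s_j} + b_j`) can start;
the time until the first of the replicas can start. -/
def IsWaitingTime (W : (Fin N → ℝ) → Job N d → ℝ) : Prop :=
  (∀ w x, W w x = latency w x - ⨅ j : Fin d, x.2.1 j) ∨
  (∀ w x, ∃ j : Fin d, w (x.1 j) + x.2.1 j = latency w x ∧ W w x = w (x.1 j)) ∨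
  (∀ w x, W w x = ⨅ j : Fin d, w (x.1 j))

/-- Expected waiting time of a job that finds a workload vector with law `π`. -/
noncomputable def expectedWaitingTime (lam : ℝ) (β : Measure ℝ) (π : Measure (Fin N → ℝ))
    (W : (Fin N → ℝ) → Job N d → ℝ) : ℝ≥0∞ :=
  ∫⁻ z, ENNReal.ofReal (W z.1 z.2) ∂(π.prod (jobLaw N d lam β))

/-- `E[min{X_1, …, X_d}]` for i.i.d. `X_j` with law `μ`. -/
noncomputable def meanMin (d : ℕ) (μ : Measure ℝ) : ℝ :=
  ∫ x, (⨅ j : Fin d, x j) ∂(Measure.pi fun _ : Fin d => μ)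

/-- `E[min{X_1, …, X_d}^2]` for i.i.d. `X_j` with law `μ`; it may be infinite. -/
noncomputable def secondMomentMin (d : ℕ) (μ : Measure ℝ) : ℝ≥0∞ :=
  ∫⁻ x, ENNReal.ofReal ((⨅ j : Fin d, x j) ^ 2) ∂(Measure.pi fun _ : Fin d => μ)

end Redundancy

/-! The largest workload `M` is controlled by a single-server queue. A job finishes no later than `M
+ S`, where `S` is its smallest service requirement, and servers it does not sample keep their
workload. Hence `M` goes to at most `(M + S - A)⁺`, the Lindley recursion of an M/G/1 queue with
service time `S` (`maxWorkload_nextWorkload_le`), whatever `N` is. Every admitted waiting time is at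
most `M`.

Bound: by stationarity, `E f(M) ≤ E f((M + S - A)⁺)` for bounded continuous increasing `f`. Let `g`
be the ramp `min(x⁺, L)`, `G` its primitive, and take `f = G + g/λ`, which the exponential step
averages to `G`. After a truncation argument this gives `0 ≤ E[G(M + S) - G(M) - g(M)/λ] ≤ E S · E
g(M) + E S²/2 - E g(M)/λ`. Solving for `E g(M)` and letting `L → ∞` gives the Pollaczek–Khinchine
value, with no moment assumption on `M` (`LindleyDominated.lintegral_le`). Finally `S = 0` unless
all `d` replicas are nonzero, so the moments of `S` are those of `K · min X_j` times `(1 - p)^d`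
(`lintegral_minService`).

Existence: Loynes' backward construction. Systems started empty ever further in the past increase
monotonically and stay below the supremum of a random walk with negative drift, finite by the strong
law. -/

namespace Redundancy

open Filter Topology Set

/-! ### Exponential interarrival times. -/

section Exponential

theorem expMeasure_eq_withDensity (r : ℝ) :
    expMeasure r = (volume.restrict (Ioi 0)).withDensity
      (fun a => ENNReal.ofReal (r * Real.exp (-(r * a)))) := by
  have h1 : expMeasure r = volume.withDensity (exponentialPDF r) := rfl
  rw [h1, ← withDensity_indicator measurableSet_Ioi]
  refine withDensity_congr_ae ?_
  have h0 : ∀ᵐ a : ℝ, a ≠ 0 := by simp [ae_iff]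
  filter_upwards [h0] with a ha
  rw [exponentialPDF_eq]
  rcases lt_or_gt_of_ne ha with h | h
  · simp [Set.indicator, h.not_ge, h.not_gt]
  · simp [Set.indicator, h.le, h]

theorem integrable_expMeasure_iff {r : ℝ} (hr : 0 < r) {f : ℝ → ℝ} :
    Integrable f (expMeasure r) ↔
      IntegrableOn (fun a => r * Real.exp (-(r * a)) * f a) (Ioi 0) := by
  rw [expMeasure_eq_withDensity, integrable_withDensity_iff_integrable_smul' (by fun_prop) (by simp)]
  have : ∀ a, (ENNReal.ofReal (r * Real.exp (-(r * a)))).toReal = r * Real.exp (-(r * a)) :=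
    fun a => ENNReal.toReal_ofReal (by positivity)
  simp only [this, smul_eq_mul, IntegrableOn]

theorem integral_expMeasure {r : ℝ} (hr : 0 < r) (f : ℝ → ℝ) :
    ∫ a, f a ∂(expMeasure r) = ∫ a in Ioi 0, r * Real.exp (-(r * a)) * f a := by
  rw [expMeasure_eq_withDensity, integral_withDensity_eq_integral_toReal_smul (by fun_prop) (by simp)]
  have : ∀ a, (ENNReal.ofReal (r * Real.exp (-(r * a)))).toReal = r * Real.exp (-(r * a)) :=
    fun a => ENNReal.toReal_ofReal (by positivity)
  simp only [this, smul_eq_mul]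

theorem ae_expMeasure_nonneg (r : ℝ) : ∀ᵐ a ∂(expMeasure r), 0 ≤ a := by
  rw [expMeasure_eq_withDensity]
  refine (withDensity_absolutelyContinuous _ _).ae_le ?_
  filter_upwards [ae_restrict_mem measurableSet_Ioi] with a ha using le_of_lt ha

theorem hasDerivAt_exp_neg_mul (r a : ℝ) :
    HasDerivAt (fun a => Real.exp (-(r * a))) (-(r * Real.exp (-(r * a)))) a := by
  have := ((hasDerivAt_id a).const_mul r).neg.exp
  simp only [id, mul_one] at this
  convert! this using 1
  simp only [Pi.neg_apply]
  ring

/-- If `g' = h ≥ 0` and `g` vanishes on the negative half-line, then `g z` is the mean of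
`g + h / r` at `z - A`, where `A` is exponential with rate `r`. -/
theorem integral_expMeasure_sub {r : ℝ} (hr : 0 < r) {g h : ℝ → ℝ}
    (hg : ∀ x, HasDerivAt g (h x) x) (hg0 : ∀ x ≤ 0, g x = 0) (hgn : ∀ x, 0 ≤ g x)
    (hhn : ∀ x, 0 ≤ h x) (z : ℝ) :
    ∫ a, (g (z - a) + h (z - a) / r) ∂(expMeasure r) = g z := by
  rw [integral_expMeasure hr]
  -- The integrand has the explicit antiderivative `-exp(-r a) g(z - a)`, which is zero once `a ≥
  -- z`.
  have hd : ∀ a ∈ Ici (0 : ℝ), HasDerivAt (fun a => -(Real.exp (-(r * a)) * g (z - a)))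
      (r * Real.exp (-(r * a)) * (g (z - a) + h (z - a) / r)) a := by
    intro a _
    have h1 : HasDerivAt (fun a => g (z - a)) (h (z - a) * (-1)) a :=
      (hg (z - a)).comp a ((hasDerivAt_id a).const_sub z)
    convert! ((hasDerivAt_exp_neg_mul r a).mul h1).neg using 1
    field_simp
    ring
  have hl : Tendsto (fun a => -(Real.exp (-(r * a)) * g (z - a))) atTop (𝓝 0) := by
    refine tendsto_const_nhds.congr' ?_
    filter_upwards [eventually_ge_atTop z] with a ha
    rw [hg0 (z - a) (by linarith)]
    simp
  rw [integral_Ioi_of_hasDerivAt_of_nonneg' hd (fun a _ => ?_) hl]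
  · simp
  · have := hgn (z - a)
    have := hhn (z - a)
    positivity

theorem mean_expMeasure_aux {r : ℝ} (hr : 0 < r) :
    (∀ a ∈ Ici (0 : ℝ), HasDerivAt (fun a => -((a + 1 / r) * Real.exp (-(r * a))))
      (r * Real.exp (-(r * a)) * a) a) ∧
    (∀ a ∈ Ioi (0 : ℝ), 0 ≤ r * Real.exp (-(r * a)) * a) ∧
    Tendsto (fun a => -((a + 1 / r) * Real.exp (-(r * a)))) atTop (𝓝 0) := by
  refine ⟨fun a _ => ?_, fun a ha => ?_, ?_⟩
  · convert! (((hasDerivAt_id a).add_const (1 / r)).mul (hasDerivAt_exp_neg_mul r a)).neg using 1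
    simp only [id]
    field_simp
    ring
  · have : (0 : ℝ) < a := ha
    positivity
  · have h1 : Tendsto (fun a : ℝ => r * a) atTop atTop := tendsto_id.const_mul_atTop hr
    have h2 := (Real.tendsto_pow_mul_exp_neg_atTop_nhds_zero 1).comp h1
    have h3 := (Real.tendsto_pow_mul_exp_neg_atTop_nhds_zero 0).comp h1
    have h4 := ((h2.const_mul (1 / r)).add (h3.const_mul (1 / r))).neg
    simp only [mul_zero, add_zero, neg_zero] at h4
    refine h4.congr fun a => ?_
    simp only [Function.comp]
    field_simp

theorem integrable_id_expMeasure {r : ℝ} (hr : 0 < r) :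
    Integrable (fun a => a) (expMeasure r) := by
  obtain ⟨h1, h2, h3⟩ := mean_expMeasure_aux hr
  exact (integrable_expMeasure_iff hr).2 (integrableOn_Ioi_deriv_of_nonneg' h1 h2 h3)

theorem integral_id_expMeasure {r : ℝ} (hr : 0 < r) :
    ∫ a, a ∂(expMeasure r) = 1 / r := by
  obtain ⟨h1, h2, h3⟩ := mean_expMeasure_aux hr
  rw [integral_expMeasure hr, integral_Ioi_of_hasDerivAt_of_nonneg' h1 h2 h3]
  simp

end Exponential

/-! ### The ramp, its primitive and the test function. -/

section TestFunction

/-- The ramp `x ↦ min (x⁺) L`. -/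
noncomputable def ramp (L x : ℝ) : ℝ := min (max x 0) L

/-- The primitive of the ramp. -/
noncomputable def rampPrimitive (L x : ℝ) : ℝ := ∫ u in (0 : ℝ)..x, ramp L u

variable {L : ℝ}

theorem continuous_ramp (L : ℝ) : Continuous (ramp L) := by unfold ramp; fun_prop

theorem monotone_ramp (L : ℝ) : Monotone (ramp L) := fun x y h => by
  unfold ramp; gcongr

theorem ramp_nonneg (hL : 0 ≤ L) (x : ℝ) : 0 ≤ ramp L x := le_min (le_max_right _ _) hL

theorem ramp_le (L x : ℝ) : ramp L x ≤ L := min_le_right _ _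

theorem ramp_of_nonpos (hL : 0 ≤ L) {x : ℝ} (hx : x ≤ 0) : ramp L x = 0 := by
  simp [ramp, hx, hL]

theorem abs_ramp_sub_le (L x y : ℝ) : |ramp L x - ramp L y| ≤ |x - y| := by
  unfold ramp
  calc |min (max x 0) L - min (max y 0) L| ≤ |max x 0 - max y 0| := by
        simpa using abs_min_sub_min_le_max (max x 0) L (max y 0) L
    _ ≤ |x - y| := by simpa using abs_max_sub_max_le_max x 0 y 0

theorem hasDerivAt_rampPrimitive (L x : ℝ) : HasDerivAt (rampPrimitive L) (ramp L x) x :=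
  intervalIntegral.integral_hasDerivAt_right ((continuous_ramp L).intervalIntegrable _ _)
    (continuous_ramp L).aestronglyMeasurable.stronglyMeasurableAtFilter (continuous_ramp L).continuousAt

theorem continuous_rampPrimitive (L : ℝ) : Continuous (rampPrimitive L) :=
  continuous_iff_continuousAt.2 fun x => (hasDerivAt_rampPrimitive L x).continuousAt

theorem rampPrimitive_sub (L x y : ℝ) :
    rampPrimitive L y - rampPrimitive L x = ∫ u in x..y, ramp L u :=
  intervalIntegral.integral_interval_sub_left ((continuous_ramp L).intervalIntegrable _ _)
    ((continuous_ramp L).intervalIntegrable _ _)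

theorem monotone_rampPrimitive (hL : 0 ≤ L) : Monotone (rampPrimitive L) := fun x y h => by
  rw [← sub_nonneg, rampPrimitive_sub]
  exact intervalIntegral.integral_nonneg h fun u _ => ramp_nonneg hL u

theorem rampPrimitive_of_nonpos (hL : 0 ≤ L) {x : ℝ} (hx : x ≤ 0) : rampPrimitive L x = 0 := by
  unfold rampPrimitive
  rw [intervalIntegral.integral_congr (g := fun _ => (0 : ℝ))]
  · simp
  · intro u hu
    rw [uIcc_of_ge hx] at hu
    exact ramp_of_nonpos hL hu.2

theorem rampPrimitive_nonneg (hL : 0 ≤ L) (x : ℝ) : 0 ≤ rampPrimitive L x := by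
  rcases le_total x 0 with h | h
  · rw [rampPrimitive_of_nonpos hL h]
  · rw [← rampPrimitive_of_nonpos hL le_rfl]
    exact monotone_rampPrimitive hL h

theorem abs_rampPrimitive_sub_le (hL : 0 ≤ L) (x y : ℝ) :
    |rampPrimitive L y - rampPrimitive L x| ≤ L * |y - x| := by
  rw [rampPrimitive_sub]
  refine intervalIntegral.norm_integral_le_of_norm_le_const (f := ramp L) fun u _ => ?_
  rw [Real.norm_of_nonneg (ramp_nonneg hL u)]
  exact ramp_le L u

/-- Second-order Taylor bound: the derivative `ramp L` is 1-Lipschitz. This is the source of the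
term `E S² / 2`. -/
theorem rampPrimitive_add_sub_le (L x : ℝ) {s : ℝ} (hs : 0 ≤ s) :
    rampPrimitive L (x + s) - rampPrimitive L x ≤ s * ramp L x + s ^ 2 / 2 := by
  rw [rampPrimitive_sub]
  calc ∫ u in x..x + s, ramp L u ≤ ∫ u in x..x + s, (ramp L x - x + u) := by
        refine intervalIntegral.integral_mono_on (by linarith)
          ((continuous_ramp L).intervalIntegrable _ _)
          (Continuous.intervalIntegrable (by fun_prop) _ _) fun u hu => ?_
        have := (le_abs_self _).trans (abs_ramp_sub_le L u x)
        rw [abs_of_nonneg (by linarith [hu.1])] at this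
        linarith
    _ = s * ramp L x + s ^ 2 / 2 := by
        rw [intervalIntegral.integral_add (by simp) (by simp)]
        simp
        ring

/-- The test function whose image under an exponential time step is `rampPrimitive`. -/
noncomputable def testFun (lam L x : ℝ) : ℝ := rampPrimitive L x + ramp L x / lam

variable {lam : ℝ}

theorem continuous_testFun (lam L : ℝ) : Continuous (testFun lam L) :=
  (continuous_rampPrimitive L).add ((continuous_ramp L).div_const _)

theorem monotone_testFun (hlam : 0 < lam) (hL : 0 ≤ L) : Monotone (testFun lam L) := fun _ _ h =>
  add_le_add (monotone_rampPrimitive hL h)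
    (div_le_div_of_nonneg_right (monotone_ramp L h) hlam.le)

theorem testFun_nonneg (hlam : 0 < lam) (hL : 0 ≤ L) (x : ℝ) : 0 ≤ testFun lam L x :=
  add_nonneg (rampPrimitive_nonneg hL x) (div_nonneg (ramp_nonneg hL x) hlam.le)

/-- Removes the positive part from the Lindley recursion, since the test function vanishes on the
negative half-line. -/
theorem testFun_max_zero (hL : 0 ≤ L) (x : ℝ) : testFun lam L (max x 0) = testFun lam L x := by
  rcases le_total x 0 with h | h
  · simp [testFun, max_eq_right h, rampPrimitive_of_nonpos hL h, ramp_of_nonpos hL h,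
      rampPrimitive_of_nonpos hL le_rfl, ramp_of_nonpos hL le_rfl]
  · rw [max_eq_left h]

theorem abs_testFun_sub_le (hlam : 0 < lam) (hL : 0 ≤ L) (x y : ℝ) :
    |testFun lam L y - testFun lam L x| ≤ (L + 1 / lam) * |y - x| := by
  have h1 := abs_rampPrimitive_sub_le hL x y
  have h2 : |(ramp L y - ramp L x) / lam| ≤ |y - x| / lam := by
    rw [abs_div, abs_of_pos hlam]
    exact div_le_div_of_nonneg_right (abs_ramp_sub_le L y x) hlam.le
  calc |testFun lam L y - testFun lam L x|
      = |(rampPrimitive L y - rampPrimitive L x) + (ramp L y - ramp L x) / lam| := by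
        unfold testFun; congr 1; ring
    _ ≤ L * |y - x| + |y - x| / lam := (abs_add_le _ _).trans (add_le_add h1 h2)
    _ = _ := by ring

theorem integral_testFun_sub (hlam : 0 < lam) (hL : 0 ≤ L) (z : ℝ) :
    ∫ a, testFun lam L (z - a) ∂(expMeasure lam) = rampPrimitive L z :=
  integral_expMeasure_sub hlam (hasDerivAt_rampPrimitive L)
    (fun _ hx => rampPrimitive_of_nonpos hL hx) (rampPrimitive_nonneg hL) (ramp_nonneg hL) z

end TestFunction

/-! ### Drift inequality and Pollaczek–Khinchine bound. -/

section Drift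

variable {lam L : ℝ} {m σ : Measure ℝ}

/-- Sub-invariance of `m` under the Lindley recursion `x ↦ (x + S - A)⁺`, with `S` of law `σ` and
`A` exponential, in the increasing stochastic order. -/
def LindleyDominated (lam : ℝ) (m σ : Measure ℝ) : Prop :=
  ∀ f : ℝ → ℝ, Monotone f → Continuous f → (∃ C, ∀ x, |f x| ≤ C) →
    ∫ x, f x ∂m ≤ ∫ z, f (max (z.1 + z.2.1 - z.2.2) 0) ∂(m.prod (σ.prod (expMeasure lam)))

theorem integrable_testFun_increment (hlam : 0 < lam) [IsProbabilityMeasure m]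
    [IsProbabilityMeasure σ] (hint : Integrable (fun s => s) σ) :
    Integrable (fun z : ℝ × ℝ × ℝ => (L + 1 / lam) * (|z.2.1| + |z.2.2|))
      (m.prod (σ.prod (expMeasure lam))) := by
  have := isProbabilityMeasure_expMeasure hlam
  have h1 : Integrable (fun y : ℝ × ℝ => |y.1| + |y.2|) (σ.prod (expMeasure lam)) :=
    (hint.abs.comp_fst _).add ((integrable_id_expMeasure hlam).abs.comp_snd _)
  exact (h1.comp_snd m).const_mul _

/-- The test function is unbounded and may fail to be `m`-integrable, so domination is applied to
its truncations at height `R`. The Lipschitz bound dominates the truncated increments by a multiple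
of `|S| + |A|`, so dominated convergence applies. -/
theorem LindleyDominated.integral_increment_nonneg (hdom : LindleyDominated lam m σ)
    (hlam : 0 < lam) (hL : 0 ≤ L) [IsProbabilityMeasure m] [IsProbabilityMeasure σ]
    (hint : Integrable (fun s => s) σ) :
    Integrable (fun z : ℝ × ℝ × ℝ => testFun lam L (z.1 + z.2.1 - z.2.2) - testFun lam L z.1)
      (m.prod (σ.prod (expMeasure lam))) ∧
    0 ≤ ∫ z : ℝ × ℝ × ℝ, (testFun lam L (z.1 + z.2.1 - z.2.2) - testFun lam L z.1)
      ∂(m.prod (σ.prod (expMeasure lam))) := by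
  have := isProbabilityMeasure_expMeasure hlam
  set P := m.prod (σ.prod (expMeasure lam)) with hP
  have hc := continuous_testFun lam L
  have hb := integrable_testFun_increment (L := L) (m := m) hlam hint
  have hbound : ∀ z : ℝ × ℝ × ℝ, |testFun lam L (z.1 + z.2.1 - z.2.2) - testFun lam L z.1| ≤
      (L + 1 / lam) * (|z.2.1| + |z.2.2|) := fun z => by
    refine (abs_testFun_sub_le hlam hL _ _).trans ?_
    gcongr
    calc |z.1 + z.2.1 - z.2.2 - z.1| = |z.2.1 - z.2.2| := by congr 1; ring
      _ ≤ _ := abs_sub _ _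
  refine ⟨hb.mono' (by fun_prop) (.of_forall hbound), ?_⟩
  have htrunc : ∀ R : ℝ, 0 ≤ R → 0 ≤ ∫ z : ℝ × ℝ × ℝ, (min (testFun lam L (z.1 + z.2.1 - z.2.2)) R
      - min (testFun lam L z.1) R) ∂P := fun R hR => by
    have hbd : ∀ x, |min (testFun lam L x) R| ≤ R := fun x => by
      rw [abs_of_nonneg (le_min (testFun_nonneg hlam hL x) hR)]
      exact min_le_right _ _
    have hi : ∀ φ : ℝ × ℝ × ℝ → ℝ, Continuous φ →
        Integrable (fun z => min (testFun lam L (φ z)) R) P := fun φ hφ =>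
      (integrable_const R).mono' (by fun_prop) (.of_forall fun z => hbd _)
    have h := hdom (fun x => min (testFun lam L x) R)
      (fun x y h => min_le_min_right _ (monotone_testFun hlam hL h)) (by fun_prop) ⟨R, hbd⟩
    simp only [testFun_max_zero hL] at h
    rw [integral_sub (hi _ (by fun_prop)) (hi _ (by fun_prop)), sub_nonneg]
    refine le_of_eq_of_le ?_ h
    have := integral_fun_fst (μ := m) (ν := σ.prod (expMeasure lam))
      (fun x => min (testFun lam L x) R)
    simpa using this
  have hlim : Tendsto (fun n : ℕ => ∫ z : ℝ × ℝ × ℝ, (min (testFun lam L (z.1 + z.2.1 - z.2.2)) n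
      - min (testFun lam L z.1) n) ∂P) atTop
      (𝓝 (∫ z : ℝ × ℝ × ℝ, (testFun lam L (z.1 + z.2.1 - z.2.2) - testFun lam L z.1) ∂P)) := by
    refine tendsto_integral_of_dominated_convergence _ (fun n => ?_) hb (fun n => ?_) ?_
    · exact Continuous.aestronglyMeasurable (by fun_prop)
    · refine .of_forall fun z => ?_
      refine le_trans ?_ (hbound z)
      simpa using abs_min_sub_min_le_max (testFun lam L (z.1 + z.2.1 - z.2.2)) (n : ℝ)
        (testFun lam L z.1) n
    · refine .of_forall fun z => tendsto_const_nhds.congr' ?_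
      filter_upwards [tendsto_natCast_atTop_atTop.eventually_ge_atTop
        (testFun lam L (z.1 + z.2.1 - z.2.2)), tendsto_natCast_atTop_atTop.eventually_ge_atTop
        (testFun lam L z.1)] with n h1 h2
      rw [min_eq_left h1, min_eq_left h2]
  exact ge_of_tendsto' hlim fun n => htrunc n n.cast_nonneg

theorem LindleyDominated.integral_ramp_le (hdom : LindleyDominated lam m σ)
    (hlam : 0 < lam) (hL : 0 ≤ L) [IsProbabilityMeasure m] [IsProbabilityMeasure σ]
    (hnonneg : ∀ᵐ s ∂σ, 0 ≤ s) (hint : Integrable (fun s => s) σ)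
    (hsq : Integrable (fun s => s ^ 2) σ) (hstable : lam * ∫ s, s ∂σ < 1) :
    ∫ x, ramp L x ∂m ≤ lam * (∫ s, s ^ 2 ∂σ) / (2 * (1 - lam * ∫ s, s ∂σ)) := by
  have := isProbabilityMeasure_expMeasure hlam
  obtain ⟨hi, h0⟩ := hdom.integral_increment_nonneg hlam hL hint
  have hr : Integrable (ramp L) m := (integrable_const L).mono'
    (continuous_ramp L).aestronglyMeasurable (.of_forall fun x => by
      rw [Real.norm_of_nonneg (ramp_nonneg hL x)]; exact ramp_le L x)
  have hinner : ∀ x s : ℝ, ∫ a, (testFun lam L (x + s - a) - testFun lam L x) ∂(expMeasure lam)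
      = rampPrimitive L (x + s) - testFun lam L x := fun x s => by
    have hc := continuous_testFun lam L
    have hi' : Integrable (fun a => testFun lam L (x + s - a)) (expMeasure lam) := by
      refine (integrable_const (testFun lam L (x + s))).mono'
        (Continuous.aestronglyMeasurable (by fun_prop)) ?_
      filter_upwards [ae_expMeasure_nonneg lam] with a ha
      rw [Real.norm_of_nonneg (testFun_nonneg hlam hL _)]
      exact monotone_testFun hlam hL (by linarith)
    rw [integral_sub hi' (integrable_const _), integral_testFun_sub hlam hL]
    simp
  -- Reassociating the product lets the exponential variable be integrated out first, turning the
  -- test function into `rampPrimitive`.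
  have hmp : MeasurePreserving MeasurableEquiv.prodAssoc
      ((m.prod σ).prod (expMeasure lam)) (m.prod (σ.prod (expMeasure lam))) :=
    measurePreserving_prodAssoc _ _ _
  have hi2 : Integrable (fun z : (ℝ × ℝ) × ℝ => testFun lam L (z.1.1 + z.1.2 - z.2) -
      testFun lam L z.1.1) ((m.prod σ).prod (expMeasure lam)) :=
    (hmp.integrable_comp_emb MeasurableEquiv.prodAssoc.measurableEmbedding).2 hi
  rw [← hmp.integral_comp'] at h0
  change 0 ≤ ∫ z : (ℝ × ℝ) × ℝ, (testFun lam L (z.1.1 + z.1.2 - z.2) -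
      testFun lam L z.1.1) ∂((m.prod σ).prod (expMeasure lam)) at h0
  rw [integral_prod _ hi2] at h0
  have hi3 := hi2.integral_prod_left
  simp only [hinner] at h0 hi3
  have i1 : Integrable (fun z : ℝ × ℝ => ramp L z.1 * z.2) (m.prod σ) := hr.mul_prod hint
  have i2 : Integrable (fun z : ℝ × ℝ => z.2 ^ 2 / 2) (m.prod σ) := (hsq.div_const 2).comp_snd m
  have i3 : Integrable (fun z : ℝ × ℝ => ramp L z.1 / lam) (m.prod σ) :=
    (hr.div_const lam).comp_fst σ
  have i12 : Integrable (fun z : ℝ × ℝ => ramp L z.1 * z.2 + z.2 ^ 2 / 2) (m.prod σ) := i1.add i2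
  have hle : ∫ z : ℝ × ℝ, (rampPrimitive L (z.1 + z.2) - testFun lam L z.1) ∂(m.prod σ) ≤
      ∫ z : ℝ × ℝ, (ramp L z.1 * z.2 + z.2 ^ 2 / 2 - ramp L z.1 / lam) ∂(m.prod σ) := by
    refine integral_mono_ae hi3 (i12.sub i3) ?_
    have : ∀ᵐ z ∂(m.prod σ), 0 ≤ z.2 := Measure.quasiMeasurePreserving_snd.ae hnonneg
    filter_upwards [this] with z hz
    have := rampPrimitive_add_sub_le L z.1 hz
    unfold testFun
    linarith
  rw [integral_sub i12 i3, integral_add i1 i2, integral_prod_mul (ramp L) (fun s : ℝ => s),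
    integral_fun_fst (fun x => ramp L x / lam), integral_fun_snd (fun x : ℝ => x ^ 2 / 2)] at hle
  simp only [integral_div, probReal_univ, one_smul] at hle
  have h1 := h0.trans hle
  rw [le_div_iff₀ (by linarith)]
  -- Multiplied by `lam`, the inequality reads `(1 - λ E S) E g(M) ≤ λ E S² / 2`.
  have h2 := mul_nonneg hlam.le h1
  have h3 : lam * ((∫ x, ramp L x ∂m) / lam) = ∫ x, ramp L x ∂m := by field_simp
  nlinarith

/-- Pollaczek–Khinchine bound for laws dominated by the Lindley recursion of an M/G/1 queue. -/
theorem LindleyDominated.lintegral_le (hdom : LindleyDominated lam m σ)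
    (hlam : 0 < lam) [IsProbabilityMeasure m] [IsProbabilityMeasure σ]
    (hnonneg : ∀ᵐ s ∂σ, 0 ≤ s) (hint : Integrable (fun s => s) σ)
    (hstable : lam * ∫ s, s ∂σ < 1) :
    ∫⁻ x, ENNReal.ofReal x ∂m ≤ ENNReal.ofReal lam * (∫⁻ s, ENNReal.ofReal (s ^ 2) ∂σ) /
      ENNReal.ofReal (2 * (1 - lam * ∫ s, s ∂σ)) := by
  have hden : 0 < 2 * (1 - lam * ∫ s, s ∂σ) := by linarith
  by_cases htop : ∫⁻ s, ENNReal.ofReal (s ^ 2) ∂σ = ∞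
  · rw [htop, ENNReal.mul_top (by simpa using hlam), ENNReal.top_div_of_ne_top ENNReal.ofReal_ne_top]
    exact le_top
  have hsq : Integrable (fun s => s ^ 2) σ :=
    ⟨by fun_prop, (hasFiniteIntegral_iff_ofReal (.of_forall fun s => sq_nonneg s)).2
      (lt_top_iff_ne_top.2 htop)⟩
  rw [← ofReal_integral_eq_lintegral_ofReal hsq (.of_forall fun s => sq_nonneg s),
    ← ENNReal.ofReal_mul hlam.le, ← ENNReal.ofReal_div_of_pos hden]
  -- Monotone convergence: the ramps increase to `x⁺`, and `ENNReal.ofReal` discards the negative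
  -- part.
  have hlim : Tendsto (fun n : ℕ => ∫⁻ x, ENNReal.ofReal (ramp n x) ∂m) atTop
      (𝓝 (∫⁻ x, ENNReal.ofReal x ∂m)) := by
    refine lintegral_tendsto_of_tendsto_of_monotone
      (fun n => ((continuous_ramp n).measurable.ennreal_ofReal).aemeasurable) ?_ ?_
    · refine .of_forall fun x i j hij => ENNReal.ofReal_le_ofReal ?_
      exact min_le_min_left _ (Nat.cast_le.2 hij)
    · refine .of_forall fun x => tendsto_const_nhds.congr' ?_
      filter_upwards [tendsto_natCast_atTop_atTop.eventually_ge_atTop (max x 0)] with n hn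
      rw [ramp, min_eq_left hn]
      rcases le_total x 0 with h | h
      · simp [h]
      · rw [max_eq_left h]
  refine le_of_tendsto' hlim fun n => ?_
  have hr : Integrable (ramp n) m := (integrable_const (n : ℝ)).mono'
    (continuous_ramp n).aestronglyMeasurable (.of_forall fun x => by
      rw [Real.norm_of_nonneg (ramp_nonneg n.cast_nonneg x)]; exact ramp_le n x)
  rw [← ofReal_integral_eq_lintegral_ofReal hr (.of_forall fun x => ramp_nonneg n.cast_nonneg x)]
  exact ENNReal.ofReal_le_ofReal
    (hdom.integral_ramp_le hlam n.cast_nonneg hnonneg hint hsq hstable)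

end Drift

/-! ### Monotonicity, continuity and domination of the workload recursion. -/

section Queue

variable {N d : ℕ}

theorem latency_mono {w w' : Fin N → ℝ} (h : w ≤ w') (x : Job N d) : latency w x ≤ latency w' x :=
  ciInf_mono (finite_range _).bddBelow fun j => by gcongr; exact h _

theorem nextWorkload_mono {w w' : Fin N → ℝ} (h : w ≤ w') (x : Job N d) :
    nextWorkload w x ≤ nextWorkload w' x := fun i => by
  unfold nextWorkload afterArrival
  have h1 := latency_mono h x
  have h2 := h i
  split_ifs <;> gcongr

theorem nextWorkload_nonneg (w : Fin N → ℝ) (x : Job N d) : 0 ≤ nextWorkload w x :=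
  fun _ => le_max_right _ _

theorem continuous_iInf_fin [NeZero d] {E : Type*} [TopologicalSpace E] {f : Fin d → E → ℝ}
    (hf : ∀ j, Continuous (f j)) : Continuous fun e => ⨅ j, f j e := by
  simp_rw [← Finset.inf'_univ_eq_ciInf]
  exact Continuous.finset_inf'_apply _ fun j _ => hf j

theorem continuous_nextWorkload [NeZero d] (x : Job N d) :
    Continuous fun w : Fin N → ℝ => nextWorkload w x := by
  have hl : Continuous fun w : Fin N → ℝ => latency w x :=
    continuous_iInf_fin fun j => by fun_prop
  refine continuous_pi fun i => ?_
  unfold nextWorkload afterArrival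
  split_ifs <;> fun_prop

theorem measurable_latency : Measurable fun z : (Fin N → ℝ) × Job N d => latency z.1 z.2 := by
  have he : Measurable fun y : (Fin N → ℝ) × Fin N => y.1 y.2 :=
    measurable_from_prod_countable_left fun i => measurable_pi_apply i
  refine Measurable.iInf fun j => ?_
  have h1 : Measurable fun z : (Fin N → ℝ) × Job N d => z.1 (z.2.1 j) :=
    he.comp (by fun_prop : Measurable fun z : (Fin N → ℝ) × Job N d => (z.1, z.2.1 j))
  fun_prop

theorem measurable_nextWorkload :
    Measurable fun z : (Fin N → ℝ) × Job N d => nextWorkload z.1 z.2 := by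
  refine measurable_pi_lambda _ fun i => ?_
  have hl := measurable_latency (N := N) (d := d)
  have hs : MeasurableSet {z : (Fin N → ℝ) × Job N d | ∃ j, z.2.1 j = i} :=
    (measurable_fst.comp measurable_snd : Measurable fun z : (Fin N → ℝ) × Job N d => z.2.1)
      (Set.to_countable {s : Fin d → Fin N | ∃ j, s j = i}).measurableSet
  have hw : Measurable fun z : (Fin N → ℝ) × Job N d => z.1 i := by fun_prop
  have ha : Measurable fun z : (Fin N → ℝ) × Job N d => afterArrival z.1 z.2 i := by
    unfold afterArrival
    exact Measurable.ite hs (hl.max hw) hw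
  unfold nextWorkload
  fun_prop

/-- The largest workload. -/
noncomputable def maxWorkload (w : Fin N → ℝ) : ℝ := ⨆ i, w i

theorem measurable_maxWorkload : Measurable (maxWorkload : (Fin N → ℝ) → ℝ) :=
  Measurable.iSup fun i => measurable_pi_apply i

theorem le_maxWorkload (w : Fin N → ℝ) (i : Fin N) : w i ≤ maxWorkload w :=
  le_ciSup (finite_range w).bddAbove i

/-- The smallest service requirement of the replicas of a job, or zero if it is negative. -/
noncomputable def minService (b : Fin d → ℝ) : ℝ := max (⨅ j, b j) 0

theorem minService_nonneg (b : Fin d → ℝ) : 0 ≤ minService b := le_max_right _ _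

theorem measurable_minService : Measurable (minService : (Fin d → ℝ) → ℝ) :=
  (Measurable.iInf fun j => measurable_pi_apply j).max measurable_const

/-- Replacing every sampled workload by the maximum makes the latency depend only on the smallest
requirement; the choice of servers drops out. -/
theorem latency_le [NeZero d] (w : Fin N → ℝ) (x : Job N d) :
    latency w x ≤ maxWorkload w + ⨅ j, x.2.1 j := by
  rw [← sub_le_iff_le_add']
  refine le_ciInf fun j => ?_
  rw [sub_le_iff_le_add']
  exact (ciInf_le (finite_range _).bddBelow j).trans (by gcongr; exact le_maxWorkload w _)

/-- The largest workload is dominated by the Lindley recursion. -/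
theorem maxWorkload_nextWorkload_le [NeZero N] [NeZero d] (w : Fin N → ℝ) (x : Job N d) :
    maxWorkload (nextWorkload w x) ≤ max (maxWorkload w + minService x.2.1 - x.2.2) 0 := by
  refine ciSup_le fun i => max_le_max_right _ (sub_le_sub_right ?_ _)
  have h1 : maxWorkload w + ⨅ j, x.2.1 j ≤ maxWorkload w + minService x.2.1 :=
    add_le_add_right (le_max_left _ _) _
  -- Servers that are not sampled keep their workload; truncating `minService` at zero covers them
  -- for every `b`.
  have h2 : maxWorkload w ≤ maxWorkload w + minService x.2.1 :=
    le_add_of_nonneg_right (le_max_right _ _)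
  have h3 := (le_maxWorkload w i).trans h2
  unfold afterArrival
  split_ifs
  · exact max_le ((latency_le w x).trans h1) h3
  · exact h3

theorem IsWaitingTime.le_maxWorkload [NeZero d] {W : (Fin N → ℝ) → Job N d → ℝ}
    (hW : IsWaitingTime W) (w : Fin N → ℝ) (x : Job N d) : W w x ≤ maxWorkload w := by
  rcases hW with h | h | h
  · rw [h, sub_le_iff_le_add]
    exact latency_le w x
  · obtain ⟨j, -, hj⟩ := h w x
    rw [hj]
    exact Redundancy.le_maxWorkload w _
  · rw [h]
    exact (ciInf_le (finite_range _).bddBelow 0).trans (Redundancy.le_maxWorkload w _)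

end Queue

/-! ### Shift structure of an i.i.d. sequence. -/

section Shift

variable {X : Type*} [MeasurableSpace X] (P : Measure X) [IsProbabilityMeasure P]

/-- An i.i.d. sequence splits into its tail and its first entry, which are independent. -/
theorem map_tail_head_infinitePi :
    (Measure.infinitePi fun _ : ℕ => P).map (fun ω => (fun k => ω (k + 1), ω 0)) =
      (Measure.infinitePi fun _ : ℕ => P).prod P := by
  set Q := Measure.infinitePi fun _ : ℕ => P
  -- `c` prepends an entry and inverts the splitting map, so it suffices to identify the law of `c`
  -- on cylinders.
  let c : (ℕ → X) × X → ℕ → X := fun z k => Nat.casesOn k z.2 z.1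
  have hc : Measurable c := measurable_pi_lambda _ fun k => by
    cases k with
    | zero => exact measurable_snd
    | succ k => exact (measurable_pi_apply k).comp measurable_fst
  have hQ : (Q.prod P).map c = Q := by
    refine Measure.eq_infinitePi _ fun s t ht => ?_
    classical
    -- The cylinder is padded with `univ` to an initial segment of indices, so that index `0`
    -- separates from the shifted rest.
    obtain ⟨n, hn⟩ : ∃ n, s ⊆ Finset.range (n + 1) :=
      ⟨s.sup id, fun k hk => Finset.mem_range.2 (Nat.lt_succ_of_le (Finset.le_sup (f := id) hk))⟩
    let t' : ℕ → Set X := fun k => if k ∈ s then t k else univ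
    have ht' : ∀ k, MeasurableSet (t' k) := fun k => by
      by_cases h : k ∈ s <;> simp [t', h, ht k]
    have hprod : ∏ k ∈ s, P (t k) = ∏ k ∈ Finset.range (n + 1), P (t' k) := by
      rw [← Finset.prod_subset hn fun k _ hk => by simp [t', hk]]
      exact Finset.prod_congr rfl fun k hk => by simp [t', hk]
    have hpre : c ⁻¹' (Set.pi s t) =
        (Set.pi (Finset.range n) fun k => t' (k + 1)) ×ˢ t' 0 := by
      ext z
      have hz : z ∈ c ⁻¹' (Set.pi s t) ↔ ∀ k ∈ Finset.range (n + 1), c z k ∈ t' k := by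
        refine ⟨fun h k _ => ?_, fun h k hk => ?_⟩
        · by_cases hk : k ∈ s
          · simpa [t', hk] using h k hk
          · simp [t', hk]
        · simpa [t', Finset.mem_coe.1 hk] using h k (hn hk)
      rw [hz]
      simp only [Set.mem_prod, Set.mem_pi, Finset.coe_range, Set.mem_Iio, Finset.mem_range]
      refine ⟨fun h => ⟨fun k hk => h (k + 1) (by omega), h 0 (by omega)⟩, fun h k hk => ?_⟩
      cases k with
      | zero => exact h.2
      | succ k => exact h.1 k (by omega)
    rw [Measure.map_apply hc (MeasurableSet.pi s.countable_toSet fun k _ => ht k), hpre,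
      Measure.prod_prod, Measure.infinitePi_pi _ fun k _ => ht' _, hprod, Finset.prod_range_succ']
  have hsplit : Measurable fun ω : ℕ → X => ((fun k => ω (k + 1), ω 0) : (ℕ → X) × X) := by
    fun_prop
  conv_lhs => rw [← hQ]
  rw [Measure.map_map hsplit hc]
  exact Measure.map_id

end Shift

/-! ### Loynes' construction of a stationary law. -/

section Loynes

variable {N d : ℕ}

/-- The workload vector at time zero of the system that starts empty `n` arrivals earlier, where
`ω k` is the job that arrives `k + 1` arrivals before time zero. -/
noncomputable def loynes : ℕ → (ℕ → Job N d) → Fin N → ℝ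
  | 0, _ => 0
  | n + 1, ω => nextWorkload (loynes n fun k => ω (k + 1)) (ω 0)

theorem measurable_loynes (n : ℕ) : Measurable (loynes n : (ℕ → Job N d) → Fin N → ℝ) := by
  induction n with
  | zero => exact measurable_const
  | succ n ih =>
    have h : Measurable fun ω : ℕ → Job N d => (loynes n fun k => ω (k + 1), ω 0) :=
      (ih.comp (measurable_pi_lambda _ fun k => measurable_pi_apply (k + 1))).prodMk
        (measurable_pi_apply 0)
    exact measurable_nextWorkload.comp h

/-- Starting one arrival earlier replaces the empty initial state by a nonnegative one; monotonicity
of the recursion carries this to time zero. -/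
theorem loynes_le_succ (n : ℕ) (ω : ℕ → Job N d) : loynes n ω ≤ loynes (n + 1) ω := by
  induction n generalizing ω with
  | zero => exact nextWorkload_nonneg _ _
  | succ n ih => exact nextWorkload_mono (ih _) _

/-- The net input of a job into the dominating single-server queue. -/
noncomputable def netInput (x : Job N d) : ℝ := minService x.2.1 - x.2.2

theorem measurable_netInput : Measurable (netInput : Job N d → ℝ) :=
  (measurable_minService.comp (by fun_prop)).sub (by fun_prop)

/-- Unrolled, the Lindley recursion is a maximum of partial sums of the net input. The empty sum `k
= 0` supplies `0 ≤ C`. -/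
theorem maxWorkload_loynes_le [NeZero N] [NeZero d] (n : ℕ) {ω : ℕ → Job N d} {C : ℝ}
    (hC : ∀ k, ∑ i ∈ Finset.range k, netInput (ω i) ≤ C) : maxWorkload (loynes n ω) ≤ C := by
  induction n generalizing ω C with
  | zero => simpa [loynes, maxWorkload] using hC 0
  | succ n ih =>
    refine (maxWorkload_nextWorkload_le _ _).trans (max_le ?_ (by simpa using hC 0))
    -- Job `ω 0` acts last, so the walk of the earlier jobs is bounded by `C` minus its net input.
    have := ih (ω := fun k => ω (k + 1)) (C := C - netInput (ω 0)) fun k => by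
      have := hC (k + 1)
      rw [Finset.sum_range_succ'] at this
      linarith
    unfold netInput at this
    linarith

/-- The workload vector at time zero of the system that has been running forever. -/
noncomputable def loynesLimit (ω : ℕ → Job N d) : Fin N → ℝ := fun i => ⨆ n, loynes n ω i

theorem measurable_loynesLimit : Measurable (loynesLimit : (ℕ → Job N d) → Fin N → ℝ) :=
  measurable_pi_lambda _ fun i => Measurable.iSup fun n =>
    (measurable_pi_apply i).comp (measurable_loynes n)

theorem tendsto_loynes [NeZero N] [NeZero d] {ω : ℕ → Job N d} {C : ℝ}
    (hC : ∀ k, ∑ i ∈ Finset.range k, netInput (ω i) ≤ C) :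
    Tendsto (fun n => loynes n ω) atTop (𝓝 (loynesLimit ω)) := by
  refine tendsto_pi_nhds.2 fun i => tendsto_atTop_ciSup
    (monotone_nat_of_le_succ fun n => loynes_le_succ n ω i) ⟨C, ?_⟩
  rintro _ ⟨n, rfl⟩
  exact (le_maxWorkload _ i).trans (maxWorkload_loynes_le n hC)

/-- Passes to the limit in the recursion for `loynes`, using continuity of the step in the workload.
-/
theorem loynesLimit_eq [NeZero N] [NeZero d] {ω : ℕ → Job N d} {C : ℝ}
    (hC : ∀ k, ∑ i ∈ Finset.range k, netInput (ω i) ≤ C) :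
    nextWorkload (loynesLimit fun k => ω (k + 1)) (ω 0) = loynesLimit ω := by
  have h1 := tendsto_loynes (ω := fun k => ω (k + 1)) (C := C - netInput (ω 0)) fun k => by
    have := hC (k + 1)
    rw [Finset.sum_range_succ'] at this
    linarith
  have h2 := ((continuous_nextWorkload (ω 0)).tendsto _).comp h1
  exact tendsto_nhds_unique h2 ((tendsto_loynes hC).comp (tendsto_add_atTop_nat 1))

/-- By the strong law the partial sums are eventually nonpositive, and an eventually bounded real
sequence is bounded. -/
theorem ae_exists_sum_netInput_le {P : Measure (Job N d)} [IsProbabilityMeasure P]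
    (hint : Integrable netInput P) (hneg : ∫ x, netInput x ∂P < 0) :
    ∀ᵐ ω ∂(Measure.infinitePi fun _ : ℕ => P),
      ∃ C, ∀ k, ∑ i ∈ Finset.range k, netInput (ω i) ≤ C := by
  set Q := Measure.infinitePi fun _ : ℕ => P
  have hmp : ∀ i, MeasurePreserving (fun ω : ℕ → Job N d => ω i) Q P := fun i =>
    measurePreserving_eval_infinitePi (fun _ : ℕ => P) i
  have hm := measurable_netInput (N := N) (d := d)
  have hind : iIndepFun (fun i (ω : ℕ → Job N d) => netInput (ω i)) Q :=
    iIndepFun_infinitePi fun _ => hm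
  have hid : ∀ i, IdentDistrib (fun ω : ℕ → Job N d => netInput (ω i))
      (fun ω => netInput (ω 0)) Q Q := fun i =>
    ⟨(hm.comp (hmp i).measurable).aemeasurable, (hm.comp (hmp 0).measurable).aemeasurable, by
      have h : ∀ k, Q.map (fun ω => netInput (ω k)) = P.map netInput := fun k => by
        rw [← (hmp k).map_eq, Measure.map_map hm (hmp k).measurable]; rfl
      rw [h, h]⟩
  have hlaw := strong_law_ae_real (fun i (ω : ℕ → Job N d) => netInput (ω i))
    ((hmp 0).integrable_comp_of_integrable hint) (fun i j hij => hind.indepFun hij) hid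
  have hmean : ∫ ω, netInput (ω 0) ∂Q = ∫ x, netInput x ∂P := by
    rw [← (hmp 0).map_eq, integral_map (hmp 0).measurable.aemeasurable hm.aestronglyMeasurable]
  rw [hmean] at hlaw
  filter_upwards [hlaw] with ω hω
  have hev : ∀ᶠ n : ℕ in atTop, ∑ i ∈ Finset.range n, netInput (ω i) ≤ 0 := by
    filter_upwards [hω.eventually_lt_const hneg, eventually_gt_atTop 0] with n hn hn0
    rw [div_lt_iff₀ (by exact_mod_cast hn0), zero_mul] at hn
    exact hn.le
  obtain ⟨C, hC⟩ := IsBoundedUnder.bddAbove_range ⟨0, eventually_map.2 hev⟩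
  exact ⟨C, fun k => hC ⟨k, rfl⟩⟩

theorem exists_stationary_of_netInput [NeZero N] [NeZero d] {P : Measure (Job N d)}
    [IsProbabilityMeasure P] (hint : Integrable netInput P) (hneg : ∫ x, netInput x ∂P < 0) :
    ∃ π : Measure (Fin N → ℝ), IsProbabilityMeasure π ∧
      (π.prod P).map (fun z => nextWorkload z.1 z.2) = π := by
  set Q := Measure.infinitePi fun _ : ℕ => P
  have hl := measurable_loynesLimit (N := N) (d := d)
  refine ⟨Q.map loynesLimit, Measure.isProbabilityMeasure_map hl.aemeasurable, ?_⟩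
  have hsplit : Measurable fun ω : ℕ → Job N d =>
      ((fun k => ω (k + 1), ω 0) : (ℕ → Job N d) × Job N d) := by fun_prop
  -- The tail has the law of the whole sequence and is independent of the head, so stationarity
  -- reduces to the almost sure identity `loynesLimit_eq`.
  have h1 : (Q.map loynesLimit).prod P = (Q.prod P).map (Prod.map loynesLimit id) := by
    rw [← Measure.map_prod_map _ _ hl measurable_id, Measure.map_id]
  rw [h1, ← map_tail_head_infinitePi P, Measure.map_map (hl.prodMap measurable_id) hsplit,
    Measure.map_map measurable_nextWorkload ((hl.prodMap measurable_id).comp hsplit)]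
  refine Measure.map_congr ?_
  filter_upwards [ae_exists_sum_netInput_le hint hneg] with ω ⟨C, hC⟩
  exact loynesLimit_eq hC

end Loynes

/-! ### Moments of the smallest scaled Bernoulli requirement. -/

section ServiceLaw

variable {d : ℕ} {μ : Measure ℝ} {K p : ℝ}

theorem isProbabilityMeasure_scaledBernoulli [IsProbabilityMeasure μ] (hp0 : 0 ≤ p) (hp1 : p ≤ 1) :
    IsProbabilityMeasure (scaledBernoulli μ K p) := by
  have : IsProbabilityMeasure (μ.map fun x => x * K) :=
    Measure.isProbabilityMeasure_map (by fun_prop)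
  refine ⟨?_⟩
  simp [scaledBernoulli, ← ENNReal.ofReal_add (sub_nonneg.2 hp1) hp0]

theorem ae_map_mul_pos (hpos : ∀ᵐ x ∂μ, 0 < x) (hK : 0 < K) :
    ∀ᵐ x ∂(μ.map fun x => x * K), x ∈ Ioi (0 : ℝ) := by
  refine (ae_map_iff (by fun_prop) measurableSet_Ioi).2 ?_
  filter_upwards [hpos] with x hx using mul_pos hx hK

theorem ae_scaledBernoulli_nonneg (hpos : ∀ᵐ x ∂μ, 0 < x) (hK : 0 < K) :
    ∀ᵐ b ∂(scaledBernoulli μ K p), 0 ≤ b := by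
  unfold scaledBernoulli
  rw [ae_add_measure_iff]
  refine ⟨Measure.ae_smul_measure ?_ _, Measure.ae_smul_measure ?_ _⟩
  · filter_upwards [ae_map_mul_pos hpos hK] with x hx using le_of_lt hx
  · rw [ae_dirac_iff (measurableSet_Ici (a := (0 : ℝ)))]

theorem restrict_scaledBernoulli (hpos : ∀ᵐ x ∂μ, 0 < x) (hK : 0 < K) :
    (scaledBernoulli μ K p).restrict (Ioi 0) =
      ENNReal.ofReal (1 - p) • μ.map (fun x => x * K) := by
  unfold scaledBernoulli
  rw [Measure.restrict_add, Measure.restrict_smul, Measure.restrict_smul,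
    Measure.restrict_eq_self_of_ae_mem (ae_map_mul_pos hpos hK), restrict_dirac' measurableSet_Ioi]
  simp

theorem pi_const_smul {X : Type*} [MeasurableSpace X] (ν : Measure X) [SigmaFinite ν] (c : ℝ≥0∞)
    (hc : c ≠ ∞) : Measure.pi (fun _ : Fin d => c • ν) = c ^ d • Measure.pi fun _ : Fin d => ν := by
  have : SigmaFinite (c • ν) := by
    lift c to NNReal using hc
    exact inferInstanceAs (SigmaFinite (c • ν))
  refine Measure.pi_eq fun s _ => ?_
  simp [Measure.pi_pi, Finset.prod_mul_distrib]

theorem minService_mul (hK : 0 ≤ K) (x : Fin d → ℝ) :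
    minService (fun j => x j * K) = minService x * K := by
  unfold minService
  rw [max_mul_of_nonneg _ _ hK, Real.iInf_mul_of_nonneg hK, zero_mul]

/-- The smallest of `d` scaled Bernoulli service requirements vanishes unless all are nonzero. -/
theorem lintegral_minService [NeZero d] [IsProbabilityMeasure μ] (hpos : ∀ᵐ x ∂μ, 0 < x)
    (hK : 0 < K) (hp0 : 0 ≤ p) (hp1 : p ≤ 1) {φ : ℝ → ℝ≥0∞} (hφ : Measurable φ) (hφ0 : φ 0 = 0) :
    ∫⁻ b, φ (minService b) ∂(Measure.pi fun _ : Fin d => scaledBernoulli μ K p) =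
      ENNReal.ofReal ((1 - p) ^ d) *
        ∫⁻ x, φ (minService x * K) ∂(Measure.pi fun _ : Fin d => μ) := by
  have := isProbabilityMeasure_scaledBernoulli (μ := μ) (K := K) hp0 hp1
  have : IsProbabilityMeasure (μ.map fun x => x * K) :=
    Measure.isProbabilityMeasure_map (by fun_prop)
  set S : Set (Fin d → ℝ) := Set.pi univ fun _ => Ioi 0 with hS
  have hSm : MeasurableSet S := MeasurableSet.univ_pi fun _ => measurableSet_Ioi
  have hnonneg : ∀ᵐ b ∂(Measure.pi fun _ : Fin d => scaledBernoulli μ K p), ∀ j, 0 ≤ b j :=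
    ae_all_iff.2 fun j => (Measure.quasiMeasurePreserving_eval _ j).ae
      (ae_scaledBernoulli_nonneg hpos hK)
  -- Outside the open positive orthant some replica is zero, so the minimum is zero and `φ 0 = 0`
  -- kills the integrand.
  have h1 : ∫⁻ b, φ (minService b) ∂(Measure.pi fun _ : Fin d => scaledBernoulli μ K p) =
      ∫⁻ b in S, φ (minService b) ∂(Measure.pi fun _ : Fin d => scaledBernoulli μ K p) := by
    rw [← lintegral_indicator hSm]
    refine lintegral_congr_ae ?_
    filter_upwards [hnonneg] with b hb
    by_cases hbS : b ∈ S
    · rw [indicator_of_mem hbS]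
    · rw [indicator_of_notMem hbS]
      simp only [hS, Set.mem_pi, mem_univ, forall_true_left, mem_Ioi, not_forall, not_lt] at hbS
      obtain ⟨j, hj⟩ := hbS
      rw [minService, max_eq_right ((ciInf_le (finite_range b).bddBelow j).trans hj), hφ0]
  -- On the orthant the product law is the product of the restricted marginals, each `1 - p` times
  -- the law of `X * K`; this yields the factor `(1 - p)^d`.
  rw [h1, Measure.restrict_pi_pi]
  simp only [restrict_scaledBernoulli hpos hK]
  rw [pi_const_smul _ _ ENNReal.ofReal_ne_top, lintegral_smul_measure, smul_eq_mul,
    ← ENNReal.ofReal_pow (sub_nonneg.2 hp1), ← Measure.pi_map_pi (fun _ => by fun_prop),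
    lintegral_map (f := fun b => φ (minService b)) (hφ.comp measurable_minService) (by fun_prop)]
  simp only [minService_mul hK.le]

theorem ae_minService_eq (hpos : ∀ᵐ x ∂μ, 0 < x) [IsProbabilityMeasure μ] :
    ∀ᵐ x ∂(Measure.pi fun _ : Fin d => μ), minService x = ⨅ j, x j := by
  have h : ∀ᵐ x ∂(Measure.pi fun _ : Fin d => μ), ∀ j, 0 < x j :=
    ae_all_iff.2 fun j => (Measure.quasiMeasurePreserving_eval _ j).ae hpos
  filter_upwards [h] with x hx
  exact max_eq_left (Real.iInf_nonneg fun j => (hx j).le)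

theorem integrable_minService [NeZero d] [IsProbabilityMeasure μ]
    (hint : Integrable (fun x => x) μ) :
    Integrable minService (Measure.pi fun _ : Fin d => μ) := by
  have h := ((measurePreserving_eval (fun _ : Fin d => μ) 0).integrable_comp_of_integrable hint).abs
  refine h.mono' measurable_minService.aestronglyMeasurable (.of_forall fun x => ?_)
  rw [Real.norm_of_nonneg (minService_nonneg x)]
  exact max_le ((ciInf_le (finite_range x).bddBelow 0).trans (le_abs_self _)) (abs_nonneg _)

theorem meanMin_eq [IsProbabilityMeasure μ] (hpos : ∀ᵐ x ∂μ, 0 < x) :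
    meanMin d μ = ∫ x, minService x ∂(Measure.pi fun _ : Fin d => μ) :=
  integral_congr_ae ((ae_minService_eq hpos).mono fun _ h => h.symm)

theorem secondMomentMin_eq [IsProbabilityMeasure μ] (hpos : ∀ᵐ x ∂μ, 0 < x) :
    secondMomentMin d μ =
      ∫⁻ x, ENNReal.ofReal (minService x ^ 2) ∂(Measure.pi fun _ : Fin d => μ) :=
  lintegral_congr_ae ((ae_minService_eq hpos).mono fun _ h => by simp only [h])

theorem lintegral_ofReal_minService_scaledBernoulli [NeZero d] [IsProbabilityMeasure μ]
    (hpos : ∀ᵐ x ∂μ, 0 < x) (hint : Integrable (fun x => x) μ) (hK : 0 < K) (hp0 : 0 ≤ p)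
    (hp1 : p ≤ 1) :
    ∫⁻ b, ENNReal.ofReal (minService b) ∂(Measure.pi fun _ : Fin d => scaledBernoulli μ K p) =
      ENNReal.ofReal ((1 - p) ^ d * meanMin d μ * K) := by
  rw [lintegral_minService hpos hK hp0 hp1 ENNReal.measurable_ofReal ENNReal.ofReal_zero,
    ← ofReal_integral_eq_lintegral_ofReal ((integrable_minService hint).mul_const K)
      (.of_forall fun x => mul_nonneg (minService_nonneg x) hK.le), integral_mul_const,
    ← ENNReal.ofReal_mul (pow_nonneg (sub_nonneg.2 hp1) d), meanMin_eq hpos, mul_assoc]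

theorem integrable_minService_scaledBernoulli [NeZero d] [IsProbabilityMeasure μ]
    (hpos : ∀ᵐ x ∂μ, 0 < x) (hint : Integrable (fun x => x) μ) (hK : 0 < K) (hp0 : 0 ≤ p)
    (hp1 : p ≤ 1) :
    Integrable minService (Measure.pi fun _ : Fin d => scaledBernoulli μ K p) := by
  refine ⟨measurable_minService.aestronglyMeasurable, ?_⟩
  rw [hasFiniteIntegral_iff_ofReal (.of_forall minService_nonneg),
    lintegral_ofReal_minService_scaledBernoulli hpos hint hK hp0 hp1]
  exact ENNReal.ofReal_lt_top

theorem integral_minService_scaledBernoulli [NeZero d] [IsProbabilityMeasure μ]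
    (hpos : ∀ᵐ x ∂μ, 0 < x) (hint : Integrable (fun x => x) μ) (hK : 0 < K) (hp0 : 0 ≤ p)
    (hp1 : p ≤ 1) :
    ∫ b, minService b ∂(Measure.pi fun _ : Fin d => scaledBernoulli μ K p) =
      (1 - p) ^ d * meanMin d μ * K := by
  rw [integral_eq_lintegral_of_nonneg_ae (.of_forall minService_nonneg)
      measurable_minService.aestronglyMeasurable,
    lintegral_ofReal_minService_scaledBernoulli hpos hint hK hp0 hp1, ENNReal.toReal_ofReal]
  have h1 : 0 ≤ meanMin d μ := by
    rw [meanMin_eq hpos]; exact integral_nonneg minService_nonneg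
  have h2 := pow_nonneg (sub_nonneg.2 hp1) d
  positivity

theorem lintegral_ofReal_sq_minService_scaledBernoulli [NeZero d] [IsProbabilityMeasure μ]
    (hpos : ∀ᵐ x ∂μ, 0 < x) (hK : 0 < K) (hp0 : 0 ≤ p) (hp1 : p ≤ 1) :
    ∫⁻ b, ENNReal.ofReal (minService b ^ 2)
        ∂(Measure.pi fun _ : Fin d => scaledBernoulli μ K p) =
      ENNReal.ofReal ((1 - p) ^ d) * (secondMomentMin d μ * ENNReal.ofReal (K ^ 2)) := by
  rw [lintegral_minService hpos hK hp0 hp1 (φ := fun s => ENNReal.ofReal (s ^ 2)) (by fun_prop)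
    (by simp), secondMomentMin_eq hpos, ← lintegral_mul_const _
    ((measurable_minService.pow_const 2).ennreal_ofReal)]
  simp_rw [mul_pow, ENNReal.ofReal_mul (sq_nonneg _)]

end ServiceLaw

/-! ### From the law of a job to the Lindley recursion. -/

section JobLaw

variable {N d : ℕ} {lam : ℝ} {β : Measure ℝ}

theorem isProbabilityMeasure_uniformOn_injective (hdN : d ≤ N) :
    IsProbabilityMeasure (uniformOn {s : Fin d → Fin N | Function.Injective s}) :=
  isProbabilityMeasure_uniformOn (Set.toFinite _) ⟨Fin.castLE hdN, Fin.castLE_injective hdN⟩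

theorem isProbabilityMeasure_jobLaw (hdN : d ≤ N) (hlam : 0 < lam) [IsProbabilityMeasure β] :
    IsProbabilityMeasure (jobLaw N d lam β) := by
  have := isProbabilityMeasure_uniformOn_injective hdN
  have := isProbabilityMeasure_expMeasure hlam
  unfold jobLaw
  infer_instance

theorem map_minService_interarrival (hdN : d ≤ N) (hlam : 0 < lam) [IsProbabilityMeasure β] :
    (jobLaw N d lam β).map (fun x => (minService x.2.1, x.2.2)) =
      ((Measure.pi fun _ : Fin d => β).map minService).prod (expMeasure lam) := by
  have := isProbabilityMeasure_uniformOn_injective hdN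
  have := isProbabilityMeasure_expMeasure hlam
  have h : (fun x : Job N d => (minService x.2.1, x.2.2)) =
      Prod.map minService id ∘ Prod.snd := rfl
  rw [h, ← Measure.map_map (measurable_minService.prodMap measurable_id) measurable_snd, jobLaw,
    measurePreserving_snd.map_eq,
    ← Measure.map_prod_map _ _ measurable_minService measurable_id, Measure.map_id]

theorem integrable_netInput (hdN : d ≤ N) (hlam : 0 < lam) [IsProbabilityMeasure β]
    (hint : Integrable minService (Measure.pi fun _ : Fin d => β)) :
    Integrable netInput (jobLaw N d lam β) ∧ ∫ x, netInput x ∂(jobLaw N d lam β) =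
      ∫ b, minService b ∂(Measure.pi fun _ : Fin d => β) - 1 / lam := by
  have := isProbabilityMeasure_uniformOn_injective hdN
  have := isProbabilityMeasure_expMeasure hlam
  have h1 : Integrable (fun y : (Fin d → ℝ) × ℝ => minService y.1)
    ((Measure.pi fun _ : Fin d => β).prod (expMeasure lam)) := hint.comp_fst _
  have h2 : Integrable (fun y : (Fin d → ℝ) × ℝ => y.2)
    ((Measure.pi fun _ : Fin d => β).prod (expMeasure lam)) :=
    (integrable_id_expMeasure hlam).comp_snd _
  refine ⟨(h1.sub h2).comp_snd _, ?_⟩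
  unfold jobLaw netInput
  rw [integral_fun_snd (fun y : (Fin d → ℝ) × ℝ => minService y.1 - y.2), integral_sub h1 h2,
    integral_fun_fst minService, integral_fun_snd (fun a : ℝ => a), integral_id_expMeasure hlam]
  simp

theorem IsStationary.lindleyDominated [NeZero N] [NeZero d] (hdN : d ≤ N) (hlam : 0 < lam)
    [IsProbabilityMeasure β] {π : Measure (Fin N → ℝ)} (hπ : IsStationary N d lam β π) :
    LindleyDominated lam (π.map maxWorkload)
      ((Measure.pi fun _ : Fin d => β).map minService) := by
  intro f hmono hcont ⟨C, hC⟩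
  have := hπ.1
  have := isProbabilityMeasure_jobLaw (β := β) hdN hlam
  have := isProbabilityMeasure_expMeasure hlam
  have hM := measurable_maxWorkload (N := N)
  have hn := measurable_nextWorkload (N := N) (d := d)
  have hsm : Measurable fun x : Job N d => (minService x.2.1, x.2.2) :=
    (measurable_minService.comp (by fun_prop)).prodMk (by fun_prop)
  have hfm := hcont.measurable
  rw [← map_minService_interarrival hdN hlam, Measure.map_prod_map _ _ hM hsm,
    integral_map (hM.prodMap hsm).aemeasurable (Continuous.aestronglyMeasurable (by fun_prop)),
    integral_map hM.aemeasurable hcont.aestronglyMeasurable]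
  -- Stationarity enters on the left only: the law of `M` becomes that of the next `M`, and the
  -- pathwise bound then compares the two integrands.
  conv_lhs => rw [← hπ.2]
  have hfM : Measurable fun w : Fin N → ℝ => f (maxWorkload w) := hfm.comp hM
  rw [integral_map hn.aemeasurable hfM.aestronglyMeasurable]
  have hi : ∀ φ : (Fin N → ℝ) × Job N d → ℝ, Measurable φ →
      Integrable (fun z => f (φ z)) (π.prod (jobLaw N d lam β)) := fun φ hφ =>
    (integrable_const C).mono' (hfm.comp hφ).aestronglyMeasurable (.of_forall fun z => hC _)
  refine integral_mono (hi _ (hM.comp hn)) (hi _ ?_)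
    fun z => hmono (maxWorkload_nextWorkload_le z.1 z.2)
  exact (by fun_prop : Measurable fun y : ℝ × ℝ × ℝ => max (y.1 + y.2.1 - y.2.2) 0).comp
    (hM.prodMap hsm)

/-- The comparison is pointwise, and `lintegral_mono` needs no measurability of `W`, so arbitrary
choices of minimizer are covered. -/
theorem expectedWaitingTime_le [NeZero d] (hdN : d ≤ N) (hlam : 0 < lam) [IsProbabilityMeasure β]
    (π : Measure (Fin N → ℝ)) [SFinite π] {W : (Fin N → ℝ) → Job N d → ℝ} (hW : IsWaitingTime W) :
    expectedWaitingTime lam β π W ≤ ∫⁻ x, ENNReal.ofReal x ∂(π.map maxWorkload) := by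
  have := isProbabilityMeasure_jobLaw (β := β) hdN hlam
  have hM := measurable_maxWorkload (N := N)
  rw [lintegral_map ENNReal.measurable_ofReal hM]
  calc expectedWaitingTime lam β π W
      ≤ ∫⁻ z, ENNReal.ofReal (maxWorkload z.1) ∂(π.prod (jobLaw N d lam β)) :=
        lintegral_mono fun z => ENNReal.ofReal_le_ofReal (hW.le_maxWorkload z.1 z.2)
    _ = ∫⁻ w, ENNReal.ofReal (maxWorkload w) ∂π := by
        rw [lintegral_prod _ (by fun_prop)]
        simp

end JobLaw

end Redundancy

/-! ### Assembly of existence and bound. -/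

theorem mainTheorem4 (N d : ℕ) (hd : 1 ≤ d) (hdN : d ≤ N) (lam : ℝ) (hlam : 0 < lam)
    (μ : Measure ℝ) [IsProbabilityMeasure μ] (hpos : ∀ᵐ x ∂μ, 0 < x) (hmean : ∫ x, x ∂μ = 1)
    (K p : ℝ) (hK : 1 ≤ K) (hp : p = 1 - 1 / K)
    (hstable : (1 - p) ^ d * lam * Redundancy.meanMin d μ * K < 1) :
    (∃ π, Redundancy.IsStationary N d lam (Redundancy.scaledBernoulli μ K p) π) ∧
    ∀ π, Redundancy.IsStationary N d lam (Redundancy.scaledBernoulli μ K p) π →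
      ∀ W : (Fin N → ℝ) → Redundancy.Job N d → ℝ, Redundancy.IsWaitingTime W →
        Redundancy.expectedWaitingTime lam (Redundancy.scaledBernoulli μ K p) π W ≤
          ENNReal.ofReal ((1 - p) ^ d * lam) * Redundancy.secondMomentMin d μ
              * ENNReal.ofReal (K ^ 2) /
            ENNReal.ofReal (2 * (1 - (1 - p) ^ d * lam * Redundancy.meanMin d μ * K)) := by
  open Redundancy in
  have hK0 : 0 < K := by linarith
  have hp0 : 0 ≤ p := by
    rw [hp, sub_nonneg, div_le_one hK0]; exact hK
  have hp1 : p ≤ 1 := by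
    rw [hp]; linarith [one_div_pos.2 hK0]
  have : NeZero d := ⟨by omega⟩
  have : NeZero N := ⟨by omega⟩
  -- A non-integrable function has Bochner integral `0`, so mean `1` forces integrability.
  have hint : Integrable (fun x => x) μ := by
    by_contra h
    rw [integral_undef h] at hmean
    exact zero_ne_one hmean
  have hβ := isProbabilityMeasure_scaledBernoulli (μ := μ) (K := K) hp0 hp1
  have hjob := isProbabilityMeasure_jobLaw (β := scaledBernoulli μ K p) hdN hlam
  have hSi := integrable_minService_scaledBernoulli (d := d) hpos hint hK0 hp0 hp1
  have hS := integral_minService_scaledBernoulli (d := d) hpos hint hK0 hp0 hp1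
  have hload : lam * ((1 - p) ^ d * meanMin d μ * K) = (1 - p) ^ d * lam * meanMin d μ * K := by
    ring
  have hm := measurable_minService (d := d)
  constructor
  · obtain ⟨h1, h2⟩ := integrable_netInput hdN hlam hSi
    refine exists_stationary_of_netInput h1 ?_
    -- The stability condition is exactly negative drift, `E S < 1 / λ`.
    rw [h2, hS, sub_neg, lt_div_iff₀ hlam, mul_comm, hload]
    exact hstable
  · intro π hπ W hW
    have := hπ.1
    refine (expectedWaitingTime_le hdN hlam π hW).trans ?_
    have := Measure.isProbabilityMeasure_map (μ := π) measurable_maxWorkload.aemeasurable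
    have := Measure.isProbabilityMeasure_map
      (μ := Measure.pi fun _ : Fin d => scaledBernoulli μ K p) hm.aemeasurable
    have hmap : ∫ s, s ∂((Measure.pi fun _ : Fin d => scaledBernoulli μ K p).map minService) =
        (1 - p) ^ d * meanMin d μ * K := by
      rw [integral_map hm.aemeasurable (by fun_prop), hS]
    have h := (hπ.lindleyDominated hdN hlam).lintegral_le hlam
      ((ae_map_iff hm.aemeasurable measurableSet_Ici).2 (.of_forall minService_nonneg))
      ((integrable_map_measure (by fun_prop) hm.aemeasurable).2 hSi)
      (by rw [hmap, hload]; exact hstable)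
    rw [hmap, hload, lintegral_map (by fun_prop) hm,
      lintegral_ofReal_sq_minService_scaledBernoulli hpos hK0 hp0 hp1] at h
    refine h.trans_eq ?_
    congr 1
    rw [ENNReal.ofReal_mul (pow_nonneg (sub_nonneg.2 hp1) d)]
    ring
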